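/- **Strong direct product theorem for quantum search.** *Problem.* For integers $0\le K\le N$, $\mathrm{SEARCH}_K(N)$ is the following task: given query access to bits $x_1,\dots,x_N\in\{0,1\}$ of which exactly $K$ are equal to $1$, find the set $\{i : x_i=1\}$. *Model.* A quantum algorithm with $T$ queries acts on some finite number of qubits. Its basis states are written $|i,z\rangle$, where $i$ is held by the $\lceil\log_2(N+1)\rceil$ leftmost bits and $z$ by all other bits. The algorithm is a sequence of arbitrary unitary transformations $U_0,\dots,U_T$ that do not depend on the input. On input $x$ it prepares $$U_T\,O_x\,U_{T-1}\,O_x\cdots O_x\,U_0\,|0\cdots 0\rangle ,$$ where $O_x|i,z\rangle=(-1)^{x_i}|i,z\rangle$ if $1\le i\le N$ and $O_x|i,z\rangle=|i,z\rangle$ otherwise. The final state is then measured in the standard basis, and the $\lceil\log_2\binom NK\rceil$ rightmost bits of the outcome are read as the number of a $K$-element subset of $\{1,\dots,N\}$ in a fixed enumeration of these $\binom NK$ subsets. The algorithm solves $\mathrm{SEARCH}_K(N)$ with probability at least $p$ if, on every input $x$ with exactly $K$ ones, the output is the number of $\{i : x_i=1\}$ with probability at least $p$. *Theorem.* There exist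 constants $\varepsilon>0$ and $0<c<1$ such that, for any $K\le N/2$, solving $\mathrm{SEARCH}_K(N)$ with probability at least $c^K$ requires $(\varepsilon-o(1))\sqrt{NK}$ queries. That is, there are $\varepsilon>0$, $0<c<1$ and a function $\delta:\mathbb N\to\mathbb R$ with $\delta(N)\to0$ as $N\to\infty$ such that, for all $N$ and all $K\le N/2$ (and for every enumeration of the $K$-element subsets), every quantum algorithm with $T$ queries that solves $\mathrm{SEARCH}_K(N)$ with probability at least $c^K$ satisfies $$T\ \ge\ (\varepsilon-\delta(N))\sqrt{NK}.$$ -/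

import Mathlib

open Filter Topology

noncomputable section

/-- The number `⌈log₂ (N + 1)⌉` of bits of the query register, which holds an index
`i ∈ {0, 1, …, N}`. -/
def queryBits (N : ℕ) : ℕ := Nat.clog 2 (N + 1)

/-- The number `⌈log₂ (N choose K)⌉` of bits that describe one of the `K`-element subsets of an
`N`-element set. -/
def outputBits (N K : ℕ) : ℕ := Nat.clog 2 (N.choose K)

/-- The Hilbert space of `n` qubits: its standard basis is indexed by the bit strings
`b = b₀ b₁ … bₙ₋₁` (`b₀` is the leftmost bit). -/
abbrev QubitSpace (n : ℕ) : Type := EuclideanSpace ℂ (Fin n → Bool)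

/-- The number written, in binary, in the `m` leftmost bits of the basis state `b`. -/
def leftValue {n : ℕ} (m : ℕ) (hm : m ≤ n) (b : Fin n → Bool) : ℕ :=
  Nat.ofBits fun j : Fin m => b (Fin.castLE hm j.rev)

/-- The number written, in binary, in the `m` rightmost bits of the basis state `b`. -/
def rightValue {n : ℕ} (m : ℕ) (hm : m ≤ n) (b : Fin n → Bool) : ℕ :=
  Nat.ofBits fun j : Fin m => b (Fin.castLE hm j).rev

/-- The phase `(-1) ^ xᵢ` for `i ∈ {1, …, N}`, and `1` for every other index (in particular for
`i = 0`). The input bit `xᵢ` is `x ⟨i - 1, _⟩`. -/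
def queryPhase {N : ℕ} (x : Fin N → Bool) (i : ℕ) : ℂ :=
  if h : 1 ≤ i ∧ i ≤ N then (if x ⟨i - 1, by omega⟩ = true then -1 else 1) else 1

/-- The query transformation `O_x`: it maps the basis state `|i, z⟩` to `(-1) ^ xᵢ |i, z⟩` if
`1 ≤ i ≤ N` and to itself otherwise, where `i` is held by the `queryBits N` leftmost qubits. -/
def oracle {N n : ℕ} (hn : queryBits N ≤ n) (x : Fin N → Bool) (ψ : QubitSpace n) :
    QubitSpace n :=
  WithLp.toLp 2 fun b => queryPhase x (leftValue (queryBits N) hn b) * ψ b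

/-- A quantum algorithm with `T` queries to `N` input bits, whose output describes a `K`-element
subset: a number of qubits, sufficient to hold a query index and to hold an output, and unitary
transformations `U 0, …, U T`, which do not depend on the input. -/
structure QueryAlgorithm (N K T : ℕ) where
  /-- the number of qubits -/
  qubits : ℕ
  queryBits_le : queryBits N ≤ qubits
  outputBits_le : outputBits N K ≤ qubits
  /-- the unitary transformations -/
  U : Fin (T + 1) → (QubitSpace qubits ≃ₗᵢ[ℂ] QubitSpace qubits)

namespace QueryAlgorithm

variable {N K T : ℕ}

/-- The initial state: the basis state all of whose bits are zero. -/
def initialState (A : QueryAlgorithm N K T) : QubitSpace A.qubits :=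
  EuclideanSpace.single (fun _ => false) 1

/-- The state `U t (O_x (U (t - 1) ( … O_x (U 0 |0⟩))))` on input `x`. -/
def stateAt (A : QueryAlgorithm N K T) (x : Fin N → Bool) (t : Fin (T + 1)) :
    QubitSpace A.qubits :=
  Fin.induction (motive := fun _ => QubitSpace A.qubits) (A.U 0 A.initialState)
    (fun s ψ => A.U s.succ (oracle A.queryBits_le x ψ)) t

/-- The final state on input `x`. -/
def finalState (A : QueryAlgorithm N K T) (x : Fin N → Bool) : QubitSpace A.qubits :=
  A.stateAt x (Fin.last T)

/-- The probability that, when the final state on input `x` is measured in the standard basis, the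
`outputBits N K` rightmost bits of the outcome are the number `v` in binary. -/
def outputProb (A : QueryAlgorithm N K T) (x : Fin N → Bool) (v : ℕ) : ℝ :=
  ∑ b : Fin A.qubits → Bool,
    if rightValue (outputBits N K) A.outputBits_le b = v then ‖A.finalState x b‖ ^ 2 else 0

/-- `A` solves `SEARCH_K(N)` with probability at least `p`: on every input `x` with exactly `K`
ones, the output is the number of the set `{i | xᵢ = 1}` with probability at least `p`. Here `code`
is the fixed enumeration of the `K`-element subsets of the `N` positions. -/
def SolvesSearch (A : QueryAlgorithm N K T)
    (code : {S : Finset (Fin N) // S.card = K} ≃ Fin (N.choose K)) (p : ℝ) : Prop :=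
  ∀ (x : Fin N → Bool) (hx : (Finset.univ.filter fun i => x i = true).card = K),
    p ≤ A.outputProb x (code ⟨Finset.univ.filter fun i => x i = true, hx⟩)

end QueryAlgorithm

end

/-! View each amplitude as a function of the input `x` and expand it in the Fourier basis of the
product of Bernoulli(`p`) laws, `p = K / N`. The energy sums `4 ^ |R|` times the squared coefficient
at `R`, over all `R` and all basis states. It starts at `1`, as the initial state ignores `x`;
unitaries preserve it (`sum_cubeEnergy_isometry`), and a query multiplies it by at most `1 + 9 * √(p
* (1 - p))` (`cubeEnergy_sign_le`). So few queries leave it at most `exp (9 / 100) ^ K`.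

Conversely, Fourier inversion and Cauchy–Schwarz bound each output probability by a factor `M` times
energy (`norm_sq_le_cubeEnergy`). An outcome names at most one subset, so summing over all
`K`-subsets gives `N.choose K * s ≤ M * energy` (`SolvesSearch.choose_mul_le`). The weight `4 ^ |R|`
makes `M` exponentially smaller in `K` than `(N / K) ^ K ≤ N.choose K`, which forces `s < (9 / 10) ^
K`. -/

/-- The weights of a biased Fourier transform on one bit, the character being scaled by `2`. -/
noncomputable def bitWeight (p : ℝ) (r y : Bool) : ℝ :=
  if r then 2 * √(p * (1 - p)) * (if y then 1 else -1) else if y then p else 1 - p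

/-- The coefficients of the inverse of the transform given by `bitWeight`. -/
noncomputable def bitDual (p : ℝ) (r x : Bool) : ℝ :=
  if r then (if x then 1 - p else -p) / (2 * √(p * (1 - p))) else 1

/-- On orthonormal characters the sign acts as a reflection with both off-diagonal entries `-2 * √(p
* (1 - p))`; doubling one character turns them into `-√(p * (1 - p))` and `-4 * √(p * (1 - p))`. -/
theorem bitWeight_mul_sign {p : ℝ} (h0 : 0 ≤ p) (h1 : p ≤ 1) (r y : Bool) :
    bitWeight p r y * (if y then -1 else 1) =
      (if r then -(1 - 2 * p) else 1 - 2 * p) * bitWeight p r y +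
        (if r then -(4 * √(p * (1 - p))) else -√(p * (1 - p))) * bitWeight p (!r) y := by
  have h := Real.mul_self_sqrt (mul_nonneg h0 (sub_nonneg.2 h1))
  cases r <;> cases y <;> simp [bitWeight] <;>
    first | ring1 | linear_combination 2 * h | linear_combination -2 * h

theorem sum_bitWeight (p : ℝ) (r : Bool) :
    ∑ y, bitWeight p r y = if r then 0 else 1 := by
  cases r <;> simp [bitWeight]

theorem sum_bitDual_mul_bitWeight {p : ℝ} (h0 : 0 < p) (h1 : p < 1) (x y : Bool) :
    ∑ r, bitDual p r x * bitWeight p r y = if x = y then 1 else 0 := by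
  have ht : √(p * (1 - p)) ≠ 0 := (Real.sqrt_pos.2 (mul_pos h0 (sub_pos.2 h1))).ne'
  cases x <;> cases y <;> simp [bitWeight, bitDual] <;> field_simp <;> ring

/-- Without the scaling by `2` these sums would be `1 / p` and `1 / (1 - p)`; the factors `4` are
the gain that the argument lives on. -/
theorem sum_bitDual_sq {p : ℝ} (h0 : 0 < p) (h1 : p < 1) (x : Bool) :
    ∑ r, bitDual p r x ^ 2 =
      if x then 1 + (1 - p) / (4 * p) else 1 + p / (4 * (1 - p)) := by
  have h1' : 0 < 1 - p := sub_pos.2 h1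
  have h := Real.sq_sqrt (mul_pos h0 h1').le
  cases x <;> simp [bitDual, div_pow, mul_pow, h] <;> field_simp <;> ring

/-! ### Biased Fourier analysis on the cube -/

section Transform

variable {ι : Type*} [Fintype ι]

/-- The weight of the input `x` in the Fourier coefficient at `R`. -/
noncomputable def cubeWeight (p : ℝ) (R x : ι → Bool) : ℝ := ∏ i, bitWeight p (R i) (x i)

variable [DecidableEq ι]

theorem cubeWeight_mul_sign {p : ℝ} (h0 : 0 ≤ p) (h1 : p ≤ 1) (R x : ι → Bool) (i : ι) :
    cubeWeight p R x * (if x i then -1 else 1) =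
      (if R i then -(1 - 2 * p) else 1 - 2 * p) * cubeWeight p R x +
        (if R i then -(4 * √(p * (1 - p))) else -√(p * (1 - p))) *
          cubeWeight p (Function.update R i (!R i)) x := by
  have h (Q : ι → Bool) : cubeWeight p Q x =
      bitWeight p (Q i) (x i) * ∏ j ∈ Finset.univ.erase i, bitWeight p (Q j) (x j) :=
    (Finset.mul_prod_erase _ _ (Finset.mem_univ i)).symm
  have h' : ∏ j ∈ Finset.univ.erase i,
      bitWeight p (Function.update R i (!R i) j) (x j) =
        ∏ j ∈ Finset.univ.erase i, bitWeight p (R j) (x j) :=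
    Finset.prod_congr rfl fun j hj => by rw [Function.update_of_ne (Finset.ne_of_mem_erase hj)]
  rw [h R, h (Function.update R i _), h', Function.update_self]
  linear_combination (∏ j ∈ Finset.univ.erase i, bitWeight p (R j) (x j)) *
    bitWeight_mul_sign h0 h1 (R i) (x i)

theorem sum_cubeWeight (p : ℝ) (R : ι → Bool) :
    ∑ x, cubeWeight p R x = if R = fun _ => false then 1 else 0 := by
  have h : ∑ x, cubeWeight p R x = ∏ i, ∑ y, bitWeight p (R i) y := by
    rw [Finset.prod_univ_sum, Fintype.piFinset_univ]; rfl
  rw [h]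
  simp only [sum_bitWeight]
  split_ifs with hR
  · simp [hR]
  · obtain ⟨i, hi⟩ := Function.ne_iff.1 hR
    exact Finset.prod_eq_zero (Finset.mem_univ i) (if_pos (by simpa using hi))

theorem sum_prod_bitDual_mul_cubeWeight {p : ℝ} (h0 : 0 < p) (h1 : p < 1) (x y : ι → Bool) :
    ∑ R : ι → Bool, (∏ i, bitDual p (R i) (x i)) * cubeWeight p R y =
      if x = y then 1 else 0 := by
  have h : ∑ R : ι → Bool, (∏ i, bitDual p (R i) (x i)) * cubeWeight p R y =
      ∏ i, ∑ r, bitDual p r (x i) * bitWeight p r (y i) := by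
    rw [Finset.prod_univ_sum, Fintype.piFinset_univ]
    simp only [cubeWeight, Finset.prod_mul_distrib]
  rw [h]
  simp only [sum_bitDual_mul_bitWeight h0 h1]
  split_ifs with hxy
  · simp [hxy]
  · obtain ⟨i, hi⟩ := Function.ne_iff.1 hxy
    exact Finset.prod_eq_zero (Finset.mem_univ i) (if_neg hi)

theorem sum_prod_bitDual_sq {p : ℝ} (h0 : 0 < p) (h1 : p < 1) (x : ι → Bool) :
    ∑ R : ι → Bool, (∏ i, bitDual p (R i) (x i)) ^ 2 =
      (1 + (1 - p) / (4 * p)) ^ (Finset.univ.filter fun i => x i = true).card *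
        (1 + p / (4 * (1 - p))) ^
          (Fintype.card ι - (Finset.univ.filter fun i => x i = true).card) := by
  have h : ∑ R : ι → Bool, (∏ i, bitDual p (R i) (x i)) ^ 2 =
      ∏ i, ∑ r, bitDual p r (x i) ^ 2 := by
    rw [Finset.prod_univ_sum, Fintype.piFinset_univ]
    simp only [Finset.prod_pow]
  rw [h]
  simp only [sum_bitDual_sq h0 h1]
  rw [Finset.prod_ite, Finset.prod_const, Finset.prod_const, ← Finset.compl_filter,
    Finset.card_compl]

/-- The Fourier coefficient at `R` of a complex function on the cube. -/
noncomputable def cubeTransform (p : ℝ) (f : (ι → Bool) → ℂ) (R : ι → Bool) : ℂ :=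
  ∑ x, (cubeWeight p R x : ℂ) * f x

/-- The weighted Fourier energy of a complex function on the cube. -/
noncomputable def cubeEnergy (p : ℝ) (f : (ι → Bool) → ℂ) : ℝ :=
  ∑ R, ‖cubeTransform p f R‖ ^ 2

theorem cubeEnergy_const (p : ℝ) (a : ℂ) : cubeEnergy p (fun _ : ι → Bool => a) = ‖a‖ ^ 2 := by
  have h (R : ι → Bool) :
      cubeTransform p (fun _ => a) R = if R = fun _ => false then a else 0 := by
    rw [cubeTransform, ← Finset.sum_mul, ← Complex.ofReal_sum, sum_cubeWeight]
    split_ifs <;> simp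
  simp [cubeEnergy, h, apply_ite]

theorem cubeTransform_inverse {p : ℝ} (h0 : 0 < p) (h1 : p < 1) (f : (ι → Bool) → ℂ)
    (x : ι → Bool) :
    ∑ R, ((∏ i, bitDual p (R i) (x i) : ℝ) : ℂ) * cubeTransform p f R = f x := by
  simp only [cubeTransform, Finset.mul_sum, ← mul_assoc, ← Complex.ofReal_mul]
  rw [Finset.sum_comm]
  have h (y : ι → Bool) :
      ∑ R : ι → Bool, (((∏ i, bitDual p (R i) (x i)) * cubeWeight p R y : ℝ) : ℂ) * f y =
        if x = y then f y else 0 := by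
    rw [← Finset.sum_mul, ← Complex.ofReal_sum, sum_prod_bitDual_mul_cubeWeight h0 h1]
    split_ifs <;> simp
  simp [h, -Complex.ofReal_mul, -Complex.ofReal_prod]

theorem norm_sq_le_cubeEnergy {p : ℝ} (h0 : 0 < p) (h1 : p < 1) (f : (ι → Bool) → ℂ)
    (x : ι → Bool) :
    ‖f x‖ ^ 2 ≤
      (1 + (1 - p) / (4 * p)) ^ (Finset.univ.filter fun i => x i = true).card *
        (1 + p / (4 * (1 - p))) ^
          (Fintype.card ι - (Finset.univ.filter fun i => x i = true).card) *
        cubeEnergy p f := by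
  rw [← sum_prod_bitDual_sq h0 h1, cubeEnergy]
  calc ‖f x‖ ^ 2
      ≤ (∑ R : ι → Bool, |∏ i, bitDual p (R i) (x i)| * ‖cubeTransform p f R‖) ^ 2 := by
        rw [← cubeTransform_inverse h0 h1 f x]
        gcongr
        refine (norm_sum_le _ _).trans (Finset.sum_le_sum fun R _ => ?_)
        rw [norm_mul, Complex.norm_real, Real.norm_eq_abs]
    _ ≤ _ := by
        refine (Finset.sum_mul_sq_le_sq_mul_sq _ _ _).trans_eq ?_
        simp only [sq_abs]

theorem cubeTransform_sign {p : ℝ} (h0 : 0 ≤ p) (h1 : p ≤ 1) (f : (ι → Bool) → ℂ) (i : ι)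
    (R : ι → Bool) :
    cubeTransform p (fun x => (if x i then -1 else 1) * f x) R =
      ((if R i then -(1 - 2 * p) else 1 - 2 * p : ℝ) : ℂ) * cubeTransform p f R +
        ((if R i then -(4 * √(p * (1 - p))) else -√(p * (1 - p)) : ℝ) : ℂ) *
          cubeTransform p f (Function.update R i (!R i)) := by
  simp only [cubeTransform, Finset.mul_sum, ← Finset.sum_add_distrib]
  refine Finset.sum_congr rfl fun x _ => ?_
  have h := congrArg Complex.ofReal (cubeWeight_mul_sign h0 h1 R x i)
  have hs : ((if x i then -1 else 1 : ℝ) : ℂ) = if x i then -1 else 1 := by split_ifs <;> simp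
  rw [Complex.ofReal_mul, Complex.ofReal_add, Complex.ofReal_mul, Complex.ofReal_mul, hs] at h
  linear_combination f x * h

theorem norm_sq_add_norm_sq_le {u t : ℝ} (ht : 0 ≤ t) (hut : u ^ 2 + 4 * t ^ 2 = 1) (a b : ℂ) :
    ‖(u : ℂ) * a + ((-t : ℝ) : ℂ) * b‖ ^ 2 + ‖((-u : ℝ) : ℂ) * b + ((-(4 * t) : ℝ) : ℂ) * a‖ ^ 2 ≤
      (1 + 9 * t) * (‖a‖ ^ 2 + ‖b‖ ^ 2) := by
  have hu : |u| ≤ 1 := abs_le_one_iff_mul_self_le_one.2 (by nlinarith)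
  have ht' : t ≤ 1 / 2 := by nlinarith
  obtain ⟨hu1, hu2⟩ := abs_le.1 hu
  have key (x y : ℝ) : (u * x - t * y) ^ 2 + (u * y + 4 * t * x) ^ 2 ≤
      (1 + 9 * t) * (x ^ 2 + y ^ 2) := by
    have h1 : 2 * (u * x * y) ≤ x ^ 2 + y ^ 2 := by
      nlinarith [mul_nonneg (sub_nonneg.2 hu2) (sq_nonneg (x + y)),
        mul_nonneg (by linarith : 0 ≤ 1 + u) (sq_nonneg (x - y))]
    -- The excess `12 * t ^ 2 * x ^ 2` becomes `6 * t * x ^ 2`; the cross term adds `3 * t`, hence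
    -- the constant `9`.
    have h2 : t ^ 2 * x ^ 2 ≤ t / 2 * x ^ 2 := by
      gcongr; nlinarith
    have h3 := mul_le_mul_of_nonneg_left h1 ht
    have h4 : u ^ 2 = 1 - 4 * t ^ 2 := by linarith
    have h5 := mul_nonneg ht (sq_nonneg y)
    have h6 := mul_nonneg (sq_nonneg t) (sq_nonneg y)
    calc _ = u ^ 2 * (x ^ 2 + y ^ 2) + t ^ 2 * y ^ 2 + 16 * (t ^ 2 * x ^ 2) +
        3 * (t * (2 * (u * x * y))) := by ring
      _ ≤ _ := by rw [h4]; nlinarith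
  simp only [← Complex.normSq_eq_norm_sq, Complex.normSq_apply, Complex.add_re, Complex.add_im,
    Complex.re_ofReal_mul, Complex.im_ofReal_mul]
  nlinarith [key a.re b.re, key a.im b.im]

theorem cubeEnergy_sign_le {p : ℝ} (h0 : 0 ≤ p) (h1 : p ≤ 1) (f : (ι → Bool) → ℂ) (i : ι) :
    cubeEnergy p (fun x => (if x i then -1 else 1) * f x) ≤
      (1 + 9 * √(p * (1 - p))) * cubeEnergy p f := by
  have hinv : Function.Involutive fun R : ι → Bool => Function.update R i (!R i) := fun R => by
    simp
  -- Pairing `R` with its flip at `i` reduces the claim to the two-dimensional inequality.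
  have hsum (g : (ι → Bool) → ℝ) : 2 * ∑ R, g R =
      ∑ R, (g R + g (Function.update R i (!R i))) := by
    rw [Finset.sum_add_distrib, two_mul]
    congr 1
    exact (Equiv.sum_comp hinv.toPerm g).symm
  have hut : (1 - 2 * p) ^ 2 + 4 * √(p * (1 - p)) ^ 2 = 1 := by
    rw [Real.sq_sqrt (mul_nonneg h0 (sub_nonneg.2 h1))]; ring
  refine le_of_mul_le_mul_left ?_ (zero_lt_two' ℝ)
  rw [mul_left_comm, cubeEnergy, cubeEnergy, hsum, hsum, Finset.mul_sum]
  refine Finset.sum_le_sum fun R _ => ?_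
  rw [cubeTransform_sign h0 h1, cubeTransform_sign h0 h1]
  simp only [Function.update_self, Function.update_idem, Bool.not_not, Function.update_eq_self]
  have hle := norm_sq_add_norm_sq_le (Real.sqrt_nonneg (p * (1 - p))) hut
  cases hR : R i
  · simpa using hle (cubeTransform p f R) (cubeTransform p f (Function.update R i true))
  · have := hle (cubeTransform p f (Function.update R i false)) (cubeTransform p f R)
    rw [add_comm, add_comm (‖cubeTransform p f R‖ ^ 2)]
    simpa using this

end Transform

/-! ### A binomial lower bound -/

theorem div_pow_le_choose {N K : ℕ} (h : K ≤ N) : ((N : ℝ) / K) ^ K ≤ N.choose K := by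
  induction K generalizing N with
  | zero => simp
  | succ k ih =>
    obtain ⟨n, rfl⟩ : ∃ n, N = n + 1 := ⟨N - 1, by omega⟩
    have hk : k ≤ n := by omega
    have hk' : (k : ℝ) ≤ n := by exact_mod_cast hk
    -- This is `(n + 1) / (k + 1) ≤ n / k`; for `k = 0` both powers are `1`, so the division by zero
    -- is harmless.
    have hpow : (((n + 1 : ℕ) : ℝ) / (k + 1 : ℕ)) ^ k ≤ ((n : ℝ) / k) ^ k := by
      rcases k.eq_zero_or_pos with rfl | hpos
      · simp
      · have : (0 : ℝ) < k := by exact_mod_cast hpos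
        gcongr ?_ ^ k
        rw [div_le_div_iff₀ (by positivity) this]
        push_cast
        nlinarith
    have hchoose : ((n + 1).choose (k + 1) : ℝ) =
        ((n + 1 : ℕ) : ℝ) / (k + 1 : ℕ) * n.choose k := by
      rw [div_mul_eq_mul_div, eq_div_iff (by positivity)]
      exact_mod_cast (Nat.add_one_mul_choose_eq n k).symm
    rw [hchoose, pow_succ']
    gcongr
    exact hpow.trans (ih hk)

/-! ### Energy of the states of an algorithm -/

/-- `U` does not depend on `x`, so it commutes with the vector-valued Fourier transform. -/
theorem sum_cubeEnergy_isometry {N n : ℕ} (p : ℝ) (U : QubitSpace n ≃ₗᵢ[ℂ] QubitSpace n)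
    (ψ : (Fin N → Bool) → QubitSpace n) :
    ∑ b, cubeEnergy p (fun x => U (ψ x) b) = ∑ b, cubeEnergy p fun x => ψ x b := by
  have h (φ : (Fin N → Bool) → QubitSpace n) : ∑ b, cubeEnergy p (fun x => φ x b) =
      ∑ R, ‖∑ x, (cubeWeight p R x : ℂ) • φ x‖ ^ 2 := by
    simp only [cubeEnergy]
    rw [Finset.sum_comm]
    simp [EuclideanSpace.norm_sq_eq, cubeTransform]
  rw [h, h]
  simp only [← map_smul, ← map_sum, LinearIsometryEquiv.norm_map]

theorem cubeEnergy_queryPhase_le {N : ℕ} {p : ℝ} (h0 : 0 ≤ p) (h1 : p ≤ 1)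
    (f : (Fin N → Bool) → ℂ) (i : ℕ) :
    cubeEnergy p (fun x => queryPhase x i * f x) ≤
      (1 + 9 * √(p * (1 - p))) * cubeEnergy p f := by
  by_cases h : 1 ≤ i ∧ i ≤ N
  · simpa only [queryPhase, dif_pos h] using cubeEnergy_sign_le h0 h1 f ⟨i - 1, by omega⟩
  · have hf : 0 ≤ cubeEnergy p f := Finset.sum_nonneg fun _ _ => by positivity
    simp only [queryPhase, dif_neg h, one_mul]
    exact le_mul_of_one_le_left hf (by linarith [Real.sqrt_nonneg (p * (1 - p))])

namespace QueryAlgorithm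

variable {N K T : ℕ}

/-- The total weighted Fourier energy of the amplitudes after `t` queries. -/
noncomputable def energy (A : QueryAlgorithm N K T) (p : ℝ) (t : Fin (T + 1)) : ℝ :=
  ∑ b, cubeEnergy p fun x => A.stateAt x t b

theorem energy_le (A : QueryAlgorithm N K T) {p : ℝ} (h0 : 0 ≤ p) (h1 : p ≤ 1)
    (t : Fin (T + 1)) : A.energy p t ≤ (1 + 9 * √(p * (1 - p))) ^ (t : ℕ) := by
  induction t using Fin.induction with
  | zero =>
    have h : A.energy p 0 = ‖A.U 0 A.initialState‖ ^ 2 := by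
      have hx (x : Fin N → Bool) : A.stateAt x 0 = A.U 0 A.initialState := rfl
      simp only [energy, hx, cubeEnergy_const, EuclideanSpace.norm_sq_eq]
    rw [h, LinearIsometryEquiv.norm_map]
    simp [initialState]
  | succ t ih =>
    have hx (x : Fin N → Bool) : A.stateAt x t.succ =
        A.U t.succ (oracle A.queryBits_le x (A.stateAt x t.castSucc)) := rfl
    have h : A.energy p t.succ =
        ∑ b, cubeEnergy p fun x => oracle A.queryBits_le x (A.stateAt x t.castSucc) b := by
      simp only [energy, hx]
      exact sum_cubeEnergy_isometry p (A.U t.succ) fun x =>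
        oracle A.queryBits_le x (A.stateAt x t.castSucc)
    rw [h, Fin.val_succ, pow_succ']
    refine le_trans ?_ (mul_le_mul_of_nonneg_left ih (by positivity))
    rw [energy, Finset.mul_sum]
    exact Finset.sum_le_sum fun b _ => cubeEnergy_queryPhase_le h0 h1 _ _

theorem SolvesSearch.choose_mul_le {A : QueryAlgorithm N K T}
    {code : {S : Finset (Fin N) // S.card = K} ≃ Fin (N.choose K)} {s : ℝ}
    (hA : A.SolvesSearch code s) {p : ℝ} (h0 : 0 < p) (h1 : p < 1) :
    N.choose K * s ≤ (1 + (1 - p) / (4 * p)) ^ K * (1 + p / (4 * (1 - p))) ^ (N - K) *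
      (1 + 9 * √(p * (1 - p))) ^ T := by
  set M := (1 + (1 - p) / (4 * p)) ^ K * (1 + p / (4 * (1 - p))) ^ (N - K)
  have h1' : 0 < 1 - p := sub_pos.2 h1
  have hM0 : 0 ≤ M := by positivity
  set e : (Fin A.qubits → Bool) → ℝ := fun b => cubeEnergy p fun x => A.finalState x b
  have he0 (b) : 0 ≤ e b := Finset.sum_nonneg fun _ _ => by positivity
  set out : (Fin A.qubits → Bool) → ℕ := rightValue (outputBits N K) A.outputBits_le
  have hS (v : Fin (N.choose K)) : s ≤ ∑ b, if out b = v then M * e b else 0 := by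
    set S := code.symm v
    set x : Fin N → Bool := fun i => decide (i ∈ S.1) with hx
    have hfilter : (Finset.univ.filter fun i => x i = true) = S.1 := by ext; simp [hx]
    have hcard : (Finset.univ.filter fun i => x i = true).card = K := by rw [hfilter, S.2]
    have hcode : code ⟨Finset.univ.filter fun i => x i = true, hcard⟩ = v := by
      rw [← code.apply_symm_apply v]
      exact congrArg code (Subtype.ext hfilter)
    have h := hA x hcard
    rw [hcode] at h
    refine h.trans (Finset.sum_le_sum fun b _ => ?_)
    split_ifs
    · have := norm_sq_le_cubeEnergy h0 h1 (fun y => A.finalState y b) x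
      rwa [hcard, Fintype.card_fin] at this
    · exact le_rfl
  calc (N.choose K : ℝ) * s = ∑ _v : Fin (N.choose K), s := by simp
    _ ≤ ∑ v : Fin (N.choose K), ∑ b, if out b = v then M * e b else 0 :=
        Finset.sum_le_sum fun v _ => hS v
    _ = ∑ b, ∑ v : Fin (N.choose K), if out b = v then M * e b else 0 := Finset.sum_comm
    _ ≤ ∑ b, M * e b := by
        refine Finset.sum_le_sum fun b _ => ?_
        -- A given outcome matches exactly one `v`, or none if its value is out of range.
        by_cases hb : out b < N.choose K
        · have h (v : Fin (N.choose K)) : out b = v ↔ (⟨out b, hb⟩ : Fin (N.choose K)) = v := by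
            rw [Fin.ext_iff]
          simp [h]
        · have h (v : Fin (N.choose K)) : out b ≠ v := fun h => hb (h ▸ v.2)
          simpa [h] using mul_nonneg hM0 (he0 b)
    _ ≤ M * (1 + 9 * √(p * (1 - p))) ^ T := by
        rw [← Finset.mul_sum]
        exact mul_le_mul_of_nonneg_left
          (A.energy_le h0.le h1.le (Fin.last T)) hM0

end QueryAlgorithm

/-! ### Numerical estimates and conclusion -/

/-- `1 / 4` comes from the zeros of the input, `9 / 100` from the queries. The bound is `(9 / 10) /
(5 / 8)`, since `3 / 4 + y / 4 ≤ 5 / 8 * y` for `y = N / K ≥ 2`. -/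
theorem exp_quarter_add_lt : Real.exp (1 / 4 + 9 / 100) < 36 / 25 := by
  have h := Real.exp_bound' (x := 17 / 50) (by norm_num) (by norm_num) (n := 4) (by norm_num)
  norm_num [Finset.sum_range_succ, Nat.factorial] at h ⊢
  linarith

theorem search_bound_lt_choose {N K T : ℕ} (hK : 0 < K) (hKN : (K : ℝ) ≤ (N : ℝ) / 2)
    (hT : (T : ℝ) < 1 / 100 * √((N : ℝ) * K)) :
    (1 + (1 - (K / N : ℝ)) / (4 * (K / N))) ^ K *
        (1 + (K / N : ℝ) / (4 * (1 - K / N))) ^ (N - K) *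
        (1 + 9 * √((K / N : ℝ) * (1 - K / N))) ^ T < N.choose K * (9 / 10) ^ K := by
  have hK0 : (0 : ℝ) < K := by exact_mod_cast hK
  have hN0 : (0 : ℝ) < N := by linarith
  have hNK0 : (0 : ℝ) < N - K := by linarith
  have hle : K ≤ N := by exact_mod_cast (by linarith : (K : ℝ) ≤ N)
  set y : ℝ := N / K with hy
  have hy2 : 2 ≤ y := by rw [hy, le_div_iff₀ hK0]; linarith
  have e1 : 1 + (1 - (K / N : ℝ)) / (4 * (K / N)) = 3 / 4 + y / 4 := by
    rw [hy]; field_simp; ring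
  have e2 : (1 + (K / N : ℝ) / (4 * (1 - K / N))) ^ (N - K) ≤ Real.exp (1 / 4) ^ K := by
    have h : (K / N : ℝ) / (4 * (1 - K / N)) = K / (4 * (N - K)) := by field_simp
    rw [h]
    calc (1 + (K : ℝ) / (4 * (N - K))) ^ (N - K)
        ≤ Real.exp ((K : ℝ) / (4 * (N - K))) ^ (N - K) := by
          gcongr
          rw [add_comm]
          exact Real.add_one_le_exp _
      _ = Real.exp (1 / 4) ^ K := by
          rw [← Real.exp_nat_mul, ← Real.exp_nat_mul, Nat.cast_sub hle]
          congr 1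
          field_simp
  have e3 : (1 + 9 * √((K / N : ℝ) * (1 - K / N))) ^ T ≤ Real.exp (9 / 100) ^ K := by
    have hs : √((K / N : ℝ) * (1 - K / N)) ≤ √(K / N : ℝ) := by
      gcongr
      exact mul_le_of_le_one_right (by positivity) (by
        have : (0 : ℝ) ≤ K / N := by positivity
        linarith)
    have hm : √((N : ℝ) * K) * √(K / N : ℝ) = K := by
      rw [← Real.sqrt_mul (by positivity), show (N : ℝ) * K * (K / N) = K * K by field_simp,
        Real.sqrt_mul_self hK0.le]
    calc (1 + 9 * √((K / N : ℝ) * (1 - K / N))) ^ T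
        ≤ Real.exp (9 * √(K / N : ℝ)) ^ T := by
          gcongr
          refine le_trans ?_ (Real.add_one_le_exp _)
          linarith
      _ ≤ Real.exp (9 / 100) ^ K := by
          rw [← Real.exp_nat_mul, ← Real.exp_nat_mul, Real.exp_le_exp]
          have := mul_le_mul_of_nonneg_right hT.le (Real.sqrt_nonneg (K / N : ℝ))
          nlinarith
  rw [e1]
  calc (3 / 4 + y / 4) ^ K * (1 + (K / N : ℝ) / (4 * (1 - K / N))) ^ (N - K) *
        (1 + 9 * √((K / N : ℝ) * (1 - K / N))) ^ T
      ≤ (3 / 4 + y / 4) ^ K * Real.exp (1 / 4) ^ K * Real.exp (9 / 100) ^ K := by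
        have : 0 ≤ 1 - (K / N : ℝ) := by
          rw [sub_nonneg, div_le_one hN0]; linarith
        gcongr
    _ = ((3 / 4 + y / 4) * Real.exp (1 / 4 + 9 / 100)) ^ K := by
        rw [Real.exp_add, mul_pow, mul_pow, mul_assoc]
    _ < (y * (9 / 10)) ^ K := by
        refine pow_lt_pow_left₀ ?_ (by positivity) hK.ne'
        have := mul_lt_mul_of_pos_left exp_quarter_add_lt (by linarith : 0 < 3 / 4 + y / 4)
        linarith
    _ ≤ N.choose K * (9 / 10) ^ K := by
        rw [mul_pow]
        gcongr
        exact div_pow_le_choose hle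

theorem mainTheorem1 :
    ∃ ε c : ℝ, 0 < ε ∧ 0 < c ∧ c < 1 ∧
      ∃ δ : ℕ → ℝ, Tendsto δ atTop (𝓝 0) ∧
        ∀ N K T : ℕ, (K : ℝ) ≤ (N : ℝ) / 2 →
          ∀ (code : {S : Finset (Fin N) // S.card = K} ≃ Fin (N.choose K))
            (A : QueryAlgorithm N K T),
            A.SolvesSearch code (c ^ K) →
              (ε - δ N) * Real.sqrt ((N : ℝ) * (K : ℝ)) ≤ (T : ℝ) := by
  -- The bound holds for every `N`, so `δ = 0` suffices.
  refine ⟨1 / 100, 9 / 10, by norm_num, by norm_num, by norm_num, fun _ => 0,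
    tendsto_const_nhds, fun N K T hKN code A hA => ?_⟩
  rw [sub_zero]
  rcases K.eq_zero_or_pos with rfl | hK
  · simp
  by_contra! hT
  have hK0 : (0 : ℝ) < K := by exact_mod_cast hK
  have hN0 : (0 : ℝ) < N := by linarith
  have h1 : (K / N : ℝ) < 1 := by rw [div_lt_one hN0]; linarith
  exact (hA.choose_mul_le (div_pos hK0 hN0) h1).not_gt (search_bound_lt_choose hK hKN hT)
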